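/- All graphs are finite, simple and undirected; $\omega(H)$ denotes the number of connected components of $H$. For a real $t>0$, a graph $G$ is $t$-tough if $\omega(G-S)\le |S|/t$ for every vertex set $S$ such that $G-S$ is disconnected. The toughness $\tau(G)$ is the largest $t$ for which $G$ is $t$-tough, with $\tau(K_n)=\infty$ for all complete graphs and $\tau(G)=0$ for disconnected graphs. A graph $G$ is minimally $t$-tough if $\tau(G)=t$ and $\tau(G-e)<t$ for every edge $e$ of $G$. A graph is claw-free if it has no induced subgraph isomorphic to $K_{1,3}$. Theorem. Up to isomorphism, the minimally $1/2$-tough, claw-free graphs are exactly the graphs that can be built up in the following way, and all graphs built in this way are connected. 1. Take a tree $T$ with at least two vertices and maximum degree at most $3$ in which the vertices of degree $1$ and the vertices of degree $3$ together form an independent set. 2. Delete every vertex of degree $3$ of $T$ and, for each of them, join its three neighbours pairwise by edges, so that they form a triangle. (If $T$ has no vertex of degree $3$, nothing is changed.) -/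

import Mathlib

namespace Toughness

open scoped ENNReal SimpleGraph

universe u

variable {V : Type u}

/-- The number `ω(G)` of connected components of `G`. -/
noncomputable def numComponents (G : SimpleGraph V) : ℕ :=
  Nat.card G.ConnectedComponent

/-- The graph `G - S` obtained from `G` by deleting the vertices of `S`. -/
abbrev deleteVerts (G : SimpleGraph V) (S : Set V) : SimpleGraph ↥(Sᶜ) :=
  G.induce Sᶜ

/-- `S` is a cutset of `G`: the graph `G - S` is disconnected
(has more than one component). -/
def IsCutset (G : SimpleGraph V) (S : Set V) : Prop :=
  1 < numComponents (deleteVerts G S)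

/-- `G` is `t`-tough (for a positive real `t`): `ω(G - S) ≤ |S| / t` for every cutset `S`. -/
def IsTough (G : SimpleGraph V) (t : ℝ) : Prop :=
  ∀ S : Set V, IsCutset G S → (numComponents (deleteVerts G S) : ℝ) ≤ (S.ncard : ℝ) / t

/-- The toughness `τ(G)`: the largest (supremal) positive real `t` for which `G` is `t`-tough.
A complete graph has no cutset, so that all `t` qualify and the value is `∞`;
for a disconnected graph no `t` qualifies (take `S = ∅`) and the value is `0`. -/
noncomputable def toughness (G : SimpleGraph V) : ℝ≥0∞ :=
  sSup (ENNReal.ofReal '' {t : ℝ | 0 < t ∧ IsTough G t})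

/-- `G` is minimally `t`-tough: `τ(G) = t`, and `τ(G - e) < t` for every edge `e` of `G`. -/
def IsMinimallyTough (G : SimpleGraph V) (t : ℝ) : Prop :=
  0 < t ∧ toughness G = ENNReal.ofReal t ∧
    ∀ e ∈ G.edgeSet, toughness (G.deleteEdges {e}) < ENNReal.ofReal t

/-- `G` has no induced subgraph isomorphic to the claw `K_{1,3}`. -/
def IsClawFree (G : SimpleGraph V) : Prop :=
  ¬ completeBipartiteGraph (Fin 1) (Fin 3) ⊴ G

/-- Delete every vertex of degree `3` of `T` and join its three neighbours pairwise:
the vertices are the vertices of `T` of degree other than `3`, and two distinct ones are adjacent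
if they are adjacent in `T` or are both neighbours of a common vertex of degree `3`. -/
def replaceDegreeThree [Fintype V] (T : SimpleGraph V) [DecidableRel T.Adj] :
    SimpleGraph {v : V // T.degree v ≠ 3} where
  Adj x y := x ≠ y ∧
    (T.Adj x y ∨ ∃ w : V, T.degree w = 3 ∧ T.Adj w x ∧ T.Adj w y)
  symm := ⟨by
    rintro x y ⟨hne, h | ⟨w, hw, hx, hy⟩⟩
    · exact ⟨hne.symm, Or.inl h.symm⟩
    · exact ⟨hne.symm, Or.inr ⟨w, hw, hy, hx⟩⟩⟩
  loopless := ⟨fun _ h => h.1 rfl⟩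

/-- `G` is (isomorphic to) a graph obtained by replacing all degree-3 vertices by triangles in
a tree on at least two vertices, of maximum degree at most `3`, in which the vertices
of degree `1` and `3` together form an independent set. -/
def IsBuiltFromTree (G : SimpleGraph V) : Prop :=
  ∃ (W : Type u) (_ : Fintype W) (T : SimpleGraph W) (_ : DecidableRel T.Adj),
    Nontrivial W ∧ T.IsTree ∧ T.maxDegree ≤ 3 ∧
    T.IsIndepSet {v | T.degree v = 1 ∨ T.degree v = 3} ∧
    Nonempty (G ≃g replaceDegreeThree T)

end Toughness

/-!
A connected claw-free graph is `1/2`-tough. More precisely, deleting a vertex of a claw-free graph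
creates at most one new component, so `G - S` has at most `|S| + 1` components
(`numComponents_deleteVerts_le`), and `G - e - S` has at most `|S| + 2`. Hence the toughness of
`G - e` can be below `1/2` only because `e` is a bridge or because `G - e - s` has three components
for a single vertex `s` (`exists_small_cutset_of_toughness_lt`). In the second case claw-freeness at
`s` shows that `s` and `e` form a triangle two of whose edges are an edge cut
(`bridge_or_triangle_of_four_le`). Applied to all edges of the graph, this says that the blocks of a
minimally `1/2`-tough claw-free graph are bridges and triangles, and that a vertex of a triangle has
a neighbour outside the triangle (`triangle_cut`, `IsTriangleCactus`). Replacing each triangle by a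
star gives a graph in which every edge is a bridge, since an edge cut of `G` consisting of a bridge
or of two edges of a triangle turns into a one-edge cut (`IsTriangleCactus.starGraph_leavesOnly`).
This is the required tree: claw-freeness bounds the degrees of the old vertices by `2`, and the
vertices of triangles have degree exactly `2`.

Conversely, let `G` be built from a tree `T`. The edge cuts of `T` consisting of one edge yield edge
cuts of `G` consisting of a bridge (`IsExpansion.leavesOnly_of_adj`) or of two edges of a triangle
(`IsExpansion.leavesOnly_of_degree_eq_three`). The neighbour of a leaf of `T` is a cut vertex of `G`,
so the toughness is exactly `1/2`. Deleting a bridge disconnects `G`; deleting an edge `xy` of a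
triangle `xyz` makes `G - z` fall into three components, since `z` has degree `2` in `T`
(`IsExpansion.toughness_deleteEdges_lt`).

Edge cuts are handled as vertex sets together with the edges leaving them (`LeavesOnly`), which makes
it easy to carry them between `G` and `T`.
-/

namespace Toughness

open scoped ENNReal SimpleGraph

universe u

/-! ### Cuts and claws -/

section Basic

variable {V : Type u} {G : SimpleGraph V}

/-- Every edge of `G` that leaves the vertex set `A` joins `u ∈ A` to a vertex of `B`, and `B` lies
outside `A`. For `B = {v}` and `G.Adj u v` the edge `uv` is a bridge; for a triangle `u, v, w` and
`B = {v, w}` the two edges of the triangle at `u` form an edge cut. -/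
structure LeavesOnly (G : SimpleGraph V) (A : Set V) (u : V) (B : Set V) : Prop where
  mem : u ∈ A
  notMem : ∀ b ∈ B, b ∉ A
  cross : ∀ ⦃a b⦄, G.Adj a b → a ∈ A → b ∉ A → a = u ∧ b ∈ B

/-- No claw is centred at `v`: of any three neighbours of `v`, two are adjacent. -/
def ClawFreeAt (G : SimpleGraph V) (v : V) : Prop :=
  ∀ ⦃a b c⦄, G.Adj v a → G.Adj v b → G.Adj v c → a ≠ b → a ≠ c → b ≠ c →
    G.Adj a b ∨ G.Adj a c ∨ G.Adj b c

theorem IsClawFree.clawFreeAt (h : IsClawFree G) (v : V) : ClawFreeAt G v := by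
  intro a b c ha hb hc hab hac hbc
  by_contra! hn
  obtain ⟨h1, h2, h3⟩ := hn
  refine h ⟨⟨⟨Sum.elim (fun _ => v) ![a, b, c], ?_⟩, ?_⟩⟩
  · rintro (x | x) (y | y) hxy <;> fin_cases x <;> fin_cases y <;>
      simp_all [ha.ne, hb.ne, hc.ne, ha.ne', hb.ne', hc.ne']
  · intro x y
    change G.Adj (Sum.elim (fun _ => v) ![a, b, c] x) (Sum.elim (fun _ => v) ![a, b, c] y) ↔ _
    rcases x with x | x <;> rcases y with y | y <;> fin_cases x <;> fin_cases y <;>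
      simp_all [completeBipartiteGraph, SimpleGraph.adj_comm]

theorem isClawFree_of_clawFreeAt (h : ∀ v, ClawFreeAt G v) : IsClawFree G := by
  rintro ⟨f⟩
  have hadj : ∀ i, G.Adj (f (Sum.inl 0)) (f (Sum.inr i)) := fun i =>
    f.map_adj_iff.2 (by simp [completeBipartiteGraph])
  have hnadj : ∀ i j, ¬ G.Adj (f (Sum.inr i)) (f (Sum.inr j)) := fun i j hij => by
    simpa [completeBipartiteGraph] using f.map_adj_iff.1 hij
  have hne : ∀ i j : Fin 3, i ≠ j → f (Sum.inr i) ≠ f (Sum.inr j) := fun i j hij h =>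
    hij (Sum.inr_injective (f.injective h))
  rcases h _ (hadj 0) (hadj 1) (hadj 2) (hne _ _ (by decide)) (hne _ _ (by decide))
    (hne _ _ (by decide)) with h | h | h <;> exact hnadj _ _ h

theorem mem_of_reachable {A : Set V} (h : ∀ ⦃a b⦄, G.Adj a b → a ∈ A → b ∈ A) {x y : V}
    (hxy : G.Reachable x y) (hx : x ∈ A) : y ∈ A := by
  obtain ⟨p⟩ := hxy
  induction p with
  | nil => exact hx
  | cons hadj _ ih => exact ih (h hadj hx)

theorem deleteEdges_adj_iff {u v a b : V} :
    (G.deleteEdges {s(u, v)}).Adj a b ↔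
      G.Adj a b ∧ ¬ ((a = u ∧ b = v) ∨ (a = v ∧ b = u)) := by
  simp [SimpleGraph.deleteEdges_adj]

theorem isBridge_of_leavesOnly {A : Set V} {u v : V} (h : LeavesOnly G A u {v}) :
    ¬ (G.deleteEdges {s(u, v)}).Reachable u v := by
  intro hr
  refine h.notMem v rfl (mem_of_reachable (fun a b hab ha => ?_) hr h.mem)
  rw [deleteEdges_adj_iff] at hab
  by_contra hb
  exact hab.2 (Or.inl (h.cross hab.1 ha hb))

theorem leavesOnly_of_not_reachable {u v : V}
    (h : ¬ (G.deleteEdges {s(u, v)}).Reachable u v) :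
    LeavesOnly G {x | (G.deleteEdges {s(u, v)}).Reachable u x} u {v} where
  mem := SimpleGraph.Reachable.refl u
  notMem := by rintro b rfl; exact h
  cross a b hab ha hb := by
    by_contra hne
    have hne' : ¬ (a = v ∧ b = u) := fun hh => h (hh.1 ▸ ha)
    exact hb (SimpleGraph.Reachable.trans ha
      (SimpleGraph.Adj.reachable (deleteEdges_adj_iff.2 ⟨hab, by simp_all⟩)))

theorem exists_leavesOnly_of_isTree (hG : G.IsTree) {u v : V} (huv : G.Adj u v) :
    ∃ A, LeavesOnly G A u {v} :=
  ⟨_, leavesOnly_of_not_reachable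
    (SimpleGraph.isAcyclic_iff_forall_adj_isBridge.1 hG.isAcyclic huv)⟩

end Basic

/-! ### Counting components after deleting vertices and edges -/

section Counting

variable {V : Type u} {G : SimpleGraph V}

/-- The spanning counterpart of `G - S`: all edges meeting `S` are removed, and the vertices of `S`
are kept as isolated vertices. -/
def isolate (G : SimpleGraph V) (S : Set V) : SimpleGraph V where
  Adj x y := G.Adj x y ∧ x ∉ S ∧ y ∉ S
  symm := ⟨fun _ _ h => ⟨h.1.symm, h.2.2, h.2.1⟩⟩
  loopless := ⟨fun _ h => h.1.ne rfl⟩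

theorem isolate_reachable_of_mem {S : Set V} {s y : V} (hs : s ∈ S)
    (h : (isolate G S).Reachable s y) : y = s :=
  mem_of_reachable (G := isolate G S) (A := {s}) (fun a _ hab (ha : a = s) => absurd (ha ▸ hs) hab.2.1) h rfl

theorem isolate_reachable_of_notMem {S : Set V} {x y : V} (hx : x ∉ S)
    (h : (isolate G S).Reachable x y) :
    ∃ hy : y ∉ S, (deleteVerts G S).Reachable ⟨x, hx⟩ ⟨y, hy⟩ :=
  mem_of_reachable (G := isolate G S) (A := {z | ∃ hz : z ∉ S, (deleteVerts G S).Reachable ⟨x, hx⟩ ⟨z, hz⟩})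
    (fun a b hab ⟨ha, hr⟩ => ⟨hab.2.2, hr.trans (SimpleGraph.Adj.reachable (by
      simpa using hab.1))⟩) h ⟨hx, SimpleGraph.Reachable.refl _⟩

theorem numComponents_deleteVerts_add_ncard_le [Finite V] (G : SimpleGraph V) (S : Set V) :
    numComponents (deleteVerts G S) + S.ncard ≤ numComponents (isolate G S) := by
  let φ : deleteVerts G S →g isolate G S :=
    ⟨fun x => x.1, fun {a b} hab => ⟨by simpa using hab, a.2, b.2⟩⟩
  have hinj : Function.Injective
      (Sum.elim (fun C : (deleteVerts G S).ConnectedComponent => C.map φ)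
        (fun s : S => (isolate G S).connectedComponentMk s.1)) := by
    rintro (C | s) (D | t) h
    · induction C using SimpleGraph.ConnectedComponent.ind with | h x =>
      induction D using SimpleGraph.ConnectedComponent.ind with | h y =>
      simp only [Sum.elim_inl, SimpleGraph.ConnectedComponent.map_mk] at h
      obtain ⟨_, hr⟩ := isolate_reachable_of_notMem x.2 (SimpleGraph.ConnectedComponent.exact h)
      exact congrArg Sum.inl (SimpleGraph.ConnectedComponent.sound hr)
    · induction C using SimpleGraph.ConnectedComponent.ind with | h x =>
      simp only [Sum.elim_inl, Sum.elim_inr, SimpleGraph.ConnectedComponent.map_mk] at h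
      obtain ⟨ht, _⟩ := isolate_reachable_of_notMem x.2 (SimpleGraph.ConnectedComponent.exact h)
      exact absurd t.2 ht
    · induction D using SimpleGraph.ConnectedComponent.ind with | h x =>
      simp only [Sum.elim_inl, Sum.elim_inr, SimpleGraph.ConnectedComponent.map_mk] at h
      obtain ⟨ht, _⟩ := isolate_reachable_of_notMem x.2
        (SimpleGraph.ConnectedComponent.exact h.symm)
      exact absurd s.2 ht
    · simp only [Sum.elim_inr] at h
      exact congrArg Sum.inr (Subtype.ext
        (isolate_reachable_of_mem s.2 (SimpleGraph.ConnectedComponent.exact h)).symm)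
  have := Nat.card_le_card_of_injective _ hinj
  rwa [Nat.card_sum, Nat.card_coe_set_eq] at this

theorem numComponents_le_of_adj_reachable [Finite V] {M N : SimpleGraph V} (hMN : M ≤ N)
    (h : ∀ ⦃a b⦄, N.Adj a b → M.Reachable a b) : numComponents M ≤ numComponents N := by
  refine Nat.card_le_card_of_injective
    (fun C : M.ConnectedComponent => C.map (SimpleGraph.Hom.ofLE hMN)) fun C D hCD => ?_
  induction C using SimpleGraph.ConnectedComponent.ind with | h x =>
  induction D using SimpleGraph.ConnectedComponent.ind with | h y =>
  simp only [SimpleGraph.ConnectedComponent.map_mk] at hCD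
  exact SimpleGraph.ConnectedComponent.sound (mem_of_reachable (A := {z | M.Reachable x z})
    (fun a b hab ha => SimpleGraph.Reachable.trans ha (h hab))
    (SimpleGraph.ConnectedComponent.exact hCD) (SimpleGraph.Reachable.refl _))

/-- If the edges of `N` outside `M` connect only the components of `s` and `t` in `M`, then `M` has
at most one component more than `N`. -/
theorem numComponents_le_succ [Finite V] {M N : SimpleGraph V} (hMN : M ≤ N) (s t : V)
    (h : ∀ ⦃a b⦄, N.Adj a b → M.Reachable a b ∨ (M.Reachable a s ∧ M.Reachable t b) ∨
      (M.Reachable a t ∧ M.Reachable s b)) :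
    numComponents M ≤ numComponents N + 1 := by
  classical
  have hN : ∀ ⦃a b⦄, N.Reachable a b → M.Reachable a b ∨ (M.Reachable a s ∧ M.Reachable t b) ∨
      (M.Reachable a t ∧ M.Reachable s b) := by
    rintro a b ⟨p⟩
    induction p with
    | nil => exact Or.inl (SimpleGraph.Reachable.refl _)
    | cons hadj _ ih =>
      rcases h hadj with h1 | ⟨h1, h2⟩ | ⟨h1, h2⟩ <;> rcases ih with h3 | ⟨h3, h4⟩ | ⟨h3, h4⟩
      · exact Or.inl (h1.trans h3)
      · exact Or.inr (Or.inl ⟨h1.trans h3, h4⟩)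
      · exact Or.inr (Or.inr ⟨h1.trans h3, h4⟩)
      · exact Or.inr (Or.inl ⟨h1, h2.trans h3⟩)
      · exact Or.inr (Or.inl ⟨h1, h4⟩)
      · exact Or.inl (h1.trans h4)
      · exact Or.inr (Or.inr ⟨h1, h2.trans h3⟩)
      · exact Or.inl (h1.trans h4)
      · exact Or.inr (Or.inr ⟨h1, h4⟩)
  -- Only the component of `t` can be merged with another one, so it is sent to an extra point.
  let g : M.ConnectedComponent → Option N.ConnectedComponent := fun C =>
    if C = M.connectedComponentMk t then none else some (C.map (SimpleGraph.Hom.ofLE hMN))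
  have hg : Function.Injective g := by
    intro C D hCD
    induction C using SimpleGraph.ConnectedComponent.ind with | h x =>
    induction D using SimpleGraph.ConnectedComponent.ind with | h y =>
    simp only [g] at hCD
    split_ifs at hCD with h1 h2 h2
    · rw [h1, h2]
    · simp only [SimpleGraph.ConnectedComponent.map_mk, Option.some.injEq] at hCD
      rw [SimpleGraph.ConnectedComponent.eq] at h1 h2
      rcases hN (SimpleGraph.ConnectedComponent.exact hCD) with h3 | ⟨-, h3⟩ | ⟨h3, -⟩
      · exact SimpleGraph.ConnectedComponent.sound h3
      · exact absurd h3.symm h2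
      · exact absurd h3 h1
  have := Nat.card_le_card_of_injective g hg
  rwa [Finite.card_option] at this

theorem numComponents_deleteEdges_le [Finite V] (G : SimpleGraph V) (u v : V) :
    numComponents (G.deleteEdges {s(u, v)}) ≤ numComponents G + 1 := by
  refine numComponents_le_succ (SimpleGraph.deleteEdges_le _) u v fun a b hab => ?_
  by_cases h : (a = u ∧ b = v) ∨ (a = v ∧ b = u)
  · rcases h with ⟨rfl, rfl⟩ | ⟨rfl, rfl⟩
    · exact Or.inr (Or.inl ⟨.refl _, .refl _⟩)
    · exact Or.inr (Or.inr ⟨.refl _, .refl _⟩)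
  · exact Or.inl (SimpleGraph.Adj.reachable (deleteEdges_adj_iff.2 ⟨hab, h⟩))

/-- Isolating one more vertex of a claw-free graph adds at most two components: any neighbour of
the vertex equals or is adjacent to one of two fixed neighbours. -/
theorem numComponents_isolate_insert_le [Finite V] {S : Set V} {s : V}
    (hG : ClawFreeAt G s) :
    numComponents (isolate G (insert s S)) ≤ numComponents (isolate G S) + 2 := by
  set L := isolate G S with hL
  set L' := isolate G (insert s S) with hL'
  have hle : L' ≤ L := fun x y h =>
    ⟨h.1, fun hx => h.2.1 (Set.mem_insert_of_mem _ hx), fun hx => h.2.2 (Set.mem_insert_of_mem _ hx)⟩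
  have hadj : ∀ {x y}, L.Adj x y → x ≠ s → y ≠ s → L'.Adj x y := fun h hx hy =>
    ⟨h.1, by simp [hx, h.2.1], by simp [hy, h.2.2]⟩
  obtain ⟨a, b, ha, hb, hab⟩ : ∃ a b, (s = a ∨ L.Adj s a) ∧ (s = b ∨ L.Adj s b) ∧
      ∀ c, L.Adj s c → L'.Reachable a c ∨ L'.Reachable b c := by
    by_cases h1 : ∃ a, L.Adj s a
    · obtain ⟨a, ha⟩ := h1
      by_cases h2 : ∃ b, L.Adj s b ∧ b ≠ a ∧ ¬ L.Adj a b
      · obtain ⟨b, hb, hba, hnab⟩ := h2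
        refine ⟨a, b, Or.inr ha, Or.inr hb, fun c hc => ?_⟩
        by_cases hca : c = a
        · exact Or.inl (hca ▸ .refl _)
        by_cases hcb : c = b
        · exact Or.inr (hcb ▸ .refl _)
        rcases hG ha.1 hb.1 hc.1 hba.symm (Ne.symm hca) (Ne.symm hcb) with h | h | h
        · exact absurd ⟨h, ha.2.2, hb.2.2⟩ hnab
        · exact Or.inl (hadj ⟨h, ha.2.2, hc.2.2⟩ ha.ne' hc.ne').reachable
        · exact Or.inr (hadj ⟨h, hb.2.2, hc.2.2⟩ hb.ne' hc.ne').reachable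
      · push Not at h2
        refine ⟨a, a, Or.inr ha, Or.inr ha, fun c hc => Or.inl ?_⟩
        by_cases hca : c = a
        · exact hca ▸ .refl _
        · exact (hadj (h2 c hc hca) ha.ne' hc.ne').reachable
    · exact ⟨s, s, Or.inl rfl, Or.inl rfl, fun c hc => absurd ⟨c, hc⟩ h1⟩
  have hM : L' ⊔ SimpleGraph.edge s a ≤ L := by
    refine sup_le hle fun x y hxy => ?_
    rw [SimpleGraph.edge_adj] at hxy
    rcases hxy with ⟨⟨rfl, rfl⟩ | ⟨rfl, rfl⟩, hne⟩
    · exact ha.resolve_left hne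
    · exact (ha.resolve_left hne.symm).symm
  have hsa : (L' ⊔ SimpleGraph.edge s a).Reachable s a := by
    by_cases h : s = a
    · exact h ▸ .refl _
    · exact SimpleGraph.Adj.reachable (Or.inr (by simp [SimpleGraph.edge_adj, h]))
  have h1 : numComponents L' ≤ numComponents (L' ⊔ SimpleGraph.edge s a) + 1 := by
    refine numComponents_le_succ le_sup_left s a fun x y hxy => ?_
    rcases hxy with hxy | hxy
    · exact Or.inl hxy.reachable
    · rw [SimpleGraph.edge_adj] at hxy
      rcases hxy with ⟨⟨rfl, rfl⟩ | ⟨rfl, rfl⟩, hne⟩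
      · exact Or.inr (Or.inl ⟨.refl _, .refl _⟩)
      · exact Or.inr (Or.inr ⟨.refl _, .refl _⟩)
  have hs : ∀ c, L.Adj s c → (L' ⊔ SimpleGraph.edge s a).Reachable s c ∨
      (L' ⊔ SimpleGraph.edge s a).Reachable b c := fun c hc =>
    (hab c hc).imp (fun h => hsa.trans (h.mono le_sup_left)) (fun h => h.mono le_sup_left)
  have h2 : numComponents (L' ⊔ SimpleGraph.edge s a) ≤ numComponents L + 1 := by
    refine numComponents_le_succ hM s b fun x y hxy => ?_
    by_cases hx : x = s
    · subst hx
      exact (hs y hxy).imp_right fun h => Or.inl ⟨.refl _, h⟩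
    by_cases hy : y = s
    · subst hy
      exact (hs x hxy.symm).imp (fun h => h.symm) fun h => Or.inr ⟨h.symm, .refl _⟩
    exact Or.inl (SimpleGraph.Adj.reachable (Or.inl (hadj hxy hx hy)))
  omega

theorem numComponents_isolate_le [Finite V] (hG : ∀ v, ClawFreeAt G v) (S : Set V) :
    numComponents (isolate G S) ≤ numComponents G + 2 * S.ncard := by
  induction S, S.toFinite using Set.Finite.induction_on with
  | empty =>
    have : isolate G ∅ = G := by ext; simp [isolate]
    simp [this]
  | @insert s S hs hfin ih =>
    have := numComponents_isolate_insert_le (S := S) (hG s)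
    rw [Set.ncard_insert_of_notMem hs hfin]
    omega

theorem numComponents_eq_one (h : G.Connected) : numComponents G = 1 := by
  have := h.nonempty
  have := h.preconnected.subsingleton_connectedComponent
  exact Nat.card_eq_one_iff_unique.2 ⟨this, ⟨G.connectedComponentMk (Classical.arbitrary V)⟩⟩

/-- A surjection onto `n` colours that is constant along edges witnesses `n` components. -/
theorem le_numComponents_of_coloring {V : Type*} [Finite V] {G : SimpleGraph V} {n : ℕ}
    (f : V → Fin n)
    (hf : ∀ ⦃a b⦄, G.Adj a b → f a = f b) (hs : Function.Surjective f) :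
    n ≤ numComponents G := by
  have hr : ∀ a b, G.Reachable a b → f a = f b := fun a b hab =>
    (mem_of_reachable (A := {x | f a = f x}) (fun x y hxy hx => Eq.trans hx (hf hxy)) hab rfl)
  let g : G.ConnectedComponent → Fin n := SimpleGraph.ConnectedComponent.lift f
    fun v w p _ => hr v w p.reachable
  have hg : Function.Surjective g := fun i => by
    obtain ⟨x, rfl⟩ := hs i
    exact ⟨G.connectedComponentMk x, rfl⟩
  simpa [numComponents] using Nat.card_le_card_of_surjective g hg

end Counting

/-! ### Toughness -/

section Toughness

variable {V : Type u} {G : SimpleGraph V}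

theorem le_toughness {t : ℝ} (ht : 0 < t) (h : IsTough G t) : ENNReal.ofReal t ≤ toughness G :=
  le_sSup ⟨t, ⟨ht, h⟩, rfl⟩

theorem toughness_le {c : ℝ} (h : ∀ t, 0 < t → IsTough G t → t ≤ c) :
    toughness G ≤ ENNReal.ofReal c := by
  refine sSup_le ?_
  rintro _ ⟨t, ⟨ht, h'⟩, rfl⟩
  exact ENNReal.ofReal_le_ofReal (h t ht h')

/-- If `G - S` has at least `n ≥ 2` components, the toughness of `G` is at most `|S| / n`. -/
theorem toughness_le_of_le_numComponents {S : Set V} {n : ℕ} (hn : 1 < n)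
    (h : n ≤ numComponents (deleteVerts G S)) :
    toughness G ≤ ENNReal.ofReal (S.ncard / n) := by
  refine toughness_le fun t ht hG => ?_
  have h1 := hG S (lt_of_lt_of_le hn h)
  have h2 : (n : ℝ) ≤ numComponents (deleteVerts G S) := by exact_mod_cast h
  have hn' : (0 : ℝ) < n := by positivity
  rw [le_div_iff₀ ht] at h1
  rw [le_div_iff₀ hn']
  nlinarith

theorem two_le_numComponents_deleteVerts [Finite V] {S A : Set V}
    (hA : ∀ ⦃a b⦄, G.Adj a b → a ∉ S → b ∉ S → a ∈ A → b ∈ A) {x y : V}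
    (hxS : x ∉ S) (hyS : y ∉ S) (hx : x ∈ A) (hy : y ∉ A) :
    2 ≤ numComponents (deleteVerts G S) := by
  classical
  refine le_numComponents_of_coloring (fun z => if z.1 ∈ A then 0 else 1) ?_ ?_
  · intro a b hab
    have hab' : G.Adj a.1 b.1 := hab
    have : a.1 ∈ A ↔ b.1 ∈ A := ⟨hA hab' a.2 b.2, hA hab'.symm b.2 a.2⟩
    simp [this]
  · intro i
    fin_cases i
    · exact ⟨⟨x, hxS⟩, by simp [hx]⟩
    · exact ⟨⟨y, hyS⟩, by simp [hy]⟩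

theorem three_le_numComponents_deleteVerts [Finite V] {S A B : Set V}
    (hA : ∀ ⦃a b⦄, G.Adj a b → a ∉ S → b ∉ S → a ∈ A → b ∈ A)
    (hB : ∀ ⦃a b⦄, G.Adj a b → a ∉ S → b ∉ S → a ∈ B → b ∈ B) {x y z : V}
    (hxS : x ∉ S) (hyS : y ∉ S) (hzS : z ∉ S) (hx : x ∈ A) (hyA : y ∉ A) (hy : y ∈ B)
    (hzA : z ∉ A) (hzB : z ∉ B) :
    3 ≤ numComponents (deleteVerts G S) := by
  classical
  refine le_numComponents_of_coloring
    (fun w => if w.1 ∈ A then 0 else if w.1 ∈ B then 1 else 2) ?_ ?_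
  · intro a b hab
    have hab' : G.Adj a.1 b.1 := hab
    have h1 : a.1 ∈ A ↔ b.1 ∈ A := ⟨hA hab' a.2 b.2, hA hab'.symm b.2 a.2⟩
    have h2 : a.1 ∈ B ↔ b.1 ∈ B := ⟨hB hab' a.2 b.2, hB hab'.symm b.2 a.2⟩
    simp [h1, h2]
  · intro i
    fin_cases i
    · exact ⟨⟨x, hxS⟩, by simp [hx]⟩
    · exact ⟨⟨y, hyS⟩, by simp [hyA, hy]⟩
    · exact ⟨⟨z, hzS⟩, by simp [hzA, hzB]⟩

/-- In a connected claw-free graph, deleting `S` leaves at most `|S| + 1` components. -/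
theorem numComponents_deleteVerts_le [Finite V] (hG : G.Connected) (hc : ∀ v, ClawFreeAt G v)
    (S : Set V) : numComponents (deleteVerts G S) ≤ S.ncard + 1 := by
  have h1 := numComponents_deleteVerts_add_ncard_le G S
  have h2 := numComponents_isolate_le hc S
  rw [numComponents_eq_one hG] at h2
  omega

theorem isTough_half [Finite V] (hG : G.Connected) (hc : ∀ v, ClawFreeAt G v) :
    IsTough G (1 / 2) := by
  intro S hS
  have h1 := numComponents_deleteVerts_le hG hc S
  have h2 : numComponents (deleteVerts G S) ≤ 2 * S.ncard := by
    unfold IsCutset at hS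
    omega
  have : (numComponents (deleteVerts G S) : ℝ) ≤ 2 * S.ncard := by exact_mod_cast h2
  linarith

theorem IsMinimallyTough.connected [Finite V] {t : ℝ} (h : IsMinimallyTough G t)
    [Nonempty V] : G.Connected := by
  refine ⟨fun x y => ?_⟩
  by_contra hxy
  have h2 : 2 ≤ numComponents (deleteVerts G ∅) :=
    two_le_numComponents_deleteVerts (A := {z | G.Reachable x z})
      (fun a b hab _ _ ha => SimpleGraph.Reachable.trans ha hab.reachable)
      (Set.notMem_empty x) (Set.notMem_empty y) (SimpleGraph.Reachable.refl x) hxy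
  have := toughness_le_of_le_numComponents one_lt_two h2
  simp [h.2.1, h.1.not_ge] at this

theorem exists_not_adj_of_toughness_ne_top [Finite V] (h : toughness G ≠ ⊤) :
    ∃ x y, x ≠ y ∧ ¬ G.Adj x y := by
  by_contra! hadj
  refine h (top_unique ?_)
  have hno : ∀ S, ¬ IsCutset G S := by
    intro S hS
    have : Subsingleton (deleteVerts G S).ConnectedComponent := by
      refine ⟨fun C D => ?_⟩
      induction C using SimpleGraph.ConnectedComponent.ind with | h x =>
      induction D using SimpleGraph.ConnectedComponent.ind with | h y =>
      by_cases hxy : x = y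
      · rw [hxy]
      · exact SimpleGraph.ConnectedComponent.sound (SimpleGraph.Adj.reachable
          (hadj x.1 y.1 fun h => hxy (Subtype.ext h)))
    exact absurd hS (not_lt.2 (Finite.card_le_one_iff_subsingleton.2 this))
  refine ENNReal.le_of_forall_nnreal_lt fun r _ => ?_
  have h1 : ENNReal.ofReal (r + 1) ≤ toughness G :=
    le_toughness (by positivity) fun S hS => absurd hS (hno S)
  refine le_trans ?_ h1
  rw [← ENNReal.ofReal_coe_nnreal]
  exact ENNReal.ofReal_le_ofReal (by linarith)

end Toughness

/-! ### Edges of a minimally `1/2`-tough claw-free graph -/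

section Edges

variable {V : Type u} {G : SimpleGraph V}

theorem isolate_deleteEdges (S : Set V) (e : Sym2 V) :
    isolate (G.deleteEdges {e}) S = (isolate G S).deleteEdges {e} := by
  ext a b
  simp only [isolate, SimpleGraph.deleteEdges_adj]
  tauto

/-- Deleting `S ∪ {e}` from a connected claw-free graph leaves at most `|S| + 2` components, so the
toughness of `G - e` drops below `1/2` only through a set `S` with at most one vertex. In the second
alternative the isolated vertex `s` is one of the four components. -/
theorem exists_small_cutset_of_toughness_lt [Finite V] (hG : G.Connected)
    (hc : ∀ v, ClawFreeAt G v) {u v : V}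
    (h : toughness (G.deleteEdges {s(u, v)}) < ENNReal.ofReal (1 / 2)) :
    2 ≤ numComponents (G.deleteEdges {s(u, v)}) ∨
      ∃ s, 4 ≤ numComponents ((isolate G {s}).deleteEdges {s(u, v)}) := by
  have hnt : ¬ IsTough (G.deleteEdges {s(u, v)}) (1 / 2) := fun h' =>
    absurd (le_toughness (by norm_num) h') (not_le.2 h)
  simp only [IsTough, not_forall, not_le] at hnt
  obtain ⟨S, hS, hlt⟩ := hnt
  have hlt' : 2 * S.ncard < numComponents (deleteVerts (G.deleteEdges {s(u, v)}) S) := by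
    have : (2 * S.ncard : ℝ) < numComponents (deleteVerts (G.deleteEdges {s(u, v)}) S) := by
      linarith
    exact_mod_cast this
  have h1 := numComponents_deleteVerts_add_ncard_le (G.deleteEdges {s(u, v)}) S
  have h2 := numComponents_isolate_le hc S
  rw [numComponents_eq_one hG] at h2
  have h3 := numComponents_deleteEdges_le (isolate G S) u v
  rw [← isolate_deleteEdges] at h3
  unfold IsCutset at hS
  obtain h0 | h0 : S.ncard = 0 ∨ S.ncard = 1 := by omega
  · left
    rw [Set.ncard_eq_zero] at h0
    have : isolate (G.deleteEdges {s(u, v)}) ∅ = G.deleteEdges {s(u, v)} := by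
      ext
      simp [isolate]
    subst h0
    rw [this] at h1
    omega
  · right
    obtain ⟨s, rfl⟩ := Set.ncard_eq_one.1 h0
    refine ⟨s, ?_⟩
    rw [← isolate_deleteEdges]
    omega

/-- If deleting the edge `uv` and the vertex `s` leaves three components and `uv` is not a bridge,
then `s` has neighbours in each of the three; claw-freeness forces those in the components of `u`
and `v` to be `u` and `v` themselves, so that `u, v, s` is a triangle. -/
theorem bridge_or_triangle_of_four_le [Finite V] (hG : G.Connected)
    {u v s : V} (hc : ClawFreeAt G s) (huv : G.Adj u v)
    (hL : numComponents (isolate G {s}) ≤ 3)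
    (h : 4 ≤ numComponents ((isolate G {s}).deleteEdges {s(u, v)})) :
    (∃ A, LeavesOnly G A u {v}) ∨
      (G.Adj s u ∧ G.Adj s v ∧ (∃ A, LeavesOnly G A u {v, s}) ∧
        ∃ c, G.Adj s c ∧ c ≠ u ∧ c ≠ v) := by
  set L := isolate G {s} with hLdef
  set K := L.deleteEdges {s(u, v)} with hK
  have hKL : K ≤ L := SimpleGraph.deleteEdges_le _
  have hKadj : ∀ {a b}, G.Adj a b → a ≠ s → b ≠ s → ¬ ((a = u ∧ b = v) ∨ (a = v ∧ b = u)) →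
      K.Adj a b := fun hab ha hb hn => deleteEdges_adj_iff.2 ⟨⟨hab, ha, hb⟩, hn⟩
  have hnr : ¬ K.Reachable u v := fun hr => by
    have := numComponents_le_of_adj_reachable hKL fun a b hab => by
      by_cases hn : (a = u ∧ b = v) ∨ (a = v ∧ b = u)
      · rcases hn with ⟨rfl, rfl⟩ | ⟨rfl, rfl⟩
        · exact hr
        · exact hr.symm
      · exact (deleteEdges_adj_iff.2 ⟨hab, hn⟩ : K.Adj a b).reachable
    omega
  have hLuv : L.Adj u v := by
    by_contra hn
    have := numComponents_le_of_adj_reachable hKL fun a b hab => by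
      refine SimpleGraph.Adj.reachable (deleteEdges_adj_iff.2 ⟨hab, ?_⟩ : K.Adj a b)
      rintro (⟨rfl, rfl⟩ | ⟨rfl, rfl⟩)
      · exact hn hab
      · exact hn hab.symm
    omega
  have hus : u ≠ s := hLuv.2.1
  have hvs : v ≠ s := hLuv.2.2
  have hsr : ∀ x, x ≠ s → ¬ K.Reachable x s := fun x hx hr =>
    hx (isolate_reachable_of_mem (Set.mem_singleton s) (hr.symm.mono hKL))
  obtain ⟨d, hds, hdu, hdv⟩ : ∃ d, d ≠ s ∧ ¬ K.Reachable d u ∧ ¬ K.Reachable d v := by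
    by_contra! hd
    have hsurj : Function.Surjective
        ![K.connectedComponentMk u, K.connectedComponentMk v, K.connectedComponentMk s] := by
      intro C
      induction C using SimpleGraph.ConnectedComponent.ind with | h x =>
      by_cases hxs : x = s
      · exact ⟨2, by simp [hxs]⟩
      by_cases hxu : K.Reachable x u
      · exact ⟨0, SimpleGraph.ConnectedComponent.sound hxu.symm⟩
      · exact ⟨1, SimpleGraph.ConnectedComponent.sound (hd x hxs hxu).symm⟩
    have := Nat.card_le_card_of_surjective _ hsurj
    rw [Nat.card_fin] at this
    unfold numComponents at h
    omega
  obtain ⟨c, hdc, hsc⟩ : ∃ c, K.Reachable d c ∧ G.Adj s c := by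
    by_contra! hno
    refine hsr d hds (mem_of_reachable (A := {x | K.Reachable d x}) (fun a b hab ha => ?_)
      (hG.preconnected d s) (SimpleGraph.Reachable.refl d))
    have has : a ≠ s := fun h => hsr d hds (h ▸ ha)
    have hbs : b ≠ s := fun h => hno a ha (h ▸ hab.symm)
    refine SimpleGraph.Reachable.trans ha (hKadj hab has hbs ?_).reachable
    rintro (⟨rfl, -⟩ | ⟨rfl, -⟩)
    · exact hdu ha
    · exact hdv ha
  have hcu : ¬ K.Reachable u c := fun h => hdu (hdc.trans h.symm)
  have hcv : ¬ K.Reachable v c := fun h => hdv (hdc.trans h.symm)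
  -- Edges leaving the components of `u` and `v` in `G - s - e`.
  have hA : ∀ {a b}, G.Adj a b → K.Reachable u a → ¬ K.Reachable u b →
      b = s ∨ (a = u ∧ b = v) := fun {a b} hab ha hb => by
    by_contra! hn
    refine hb (ha.trans (hKadj hab (fun h => hsr u hus (h ▸ ha)) hn.1 ?_).reachable)
    rintro (⟨rfl, rfl⟩ | ⟨rfl, rfl⟩)
    · exact hn.2 rfl rfl
    · exact hnr ha
  have hB : ∀ {a b}, G.Adj a b → K.Reachable v a → ¬ K.Reachable v b →
      b = s ∨ (a = v ∧ b = u) := fun {a b} hab ha hb => by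
    by_contra! hn
    refine hb (ha.trans (hKadj hab (fun h => hsr v hvs (h ▸ ha)) hn.1 ?_).reachable)
    rintro (⟨rfl, rfl⟩ | ⟨rfl, rfl⟩)
    · exact hnr ha.symm
    · exact hn.2 rfl rfl
  by_cases hsA : ∃ a, G.Adj s a ∧ K.Reachable u a
  swap
  · refine Or.inl ⟨{x | K.Reachable u x}, .refl u, by rintro b rfl; exact hnr, fun a b hab ha hb => ?_⟩
    refine (hA hab ha hb).resolve_left ?_
    rintro rfl
    exact hsA ⟨a, hab.symm, ha⟩
  by_cases hsB : ∃ b, G.Adj s b ∧ K.Reachable v b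
  swap
  · refine Or.inl ⟨{x | ¬ K.Reachable v x}, fun h => hnr h.symm,
      by rintro b rfl hn; exact hn (.refl _), fun a b hab ha hb => ?_⟩
    refine (hB hab.symm (not_not.1 hb) ha).elim ?_ fun h => ⟨h.2, h.1⟩
    rintro rfl
    exact absurd ⟨b, hab, not_not.1 hb⟩ hsB
  -- Three neighbours of `s`, one in each of the three components: only `u` and `v` are adjacent.
  have hkey : ∀ {a b}, G.Adj s a → K.Reachable u a → G.Adj s b → K.Reachable v b →
      a = u ∧ b = v := fun {a b} hsa ha hsb hb => by
    have hub : ¬ K.Reachable u b := fun h => hnr (h.trans hb.symm)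
    have hab : a ≠ b := fun h => hub (h ▸ ha)
    have hac : a ≠ c := fun h => hcu (h ▸ ha)
    have hbc : b ≠ c := fun h => hcv (h ▸ hb)
    rcases hc hsa hsb hsc hab hac hbc with h | h | h
    · exact (hA h ha hub).resolve_left hsb.ne'
    · rcases hA h ha hcu with h | h
      · exact absurd h hsc.ne'
      · exact absurd (h.2 ▸ .refl _) hcv
    · rcases hB h hb hcv with h | h
      · exact absurd h hsc.ne'
      · exact absurd (h.2 ▸ .refl _) hcu
  obtain ⟨a, hsa, ha⟩ := hsA
  obtain ⟨b, hsb, hb⟩ := hsB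
  obtain ⟨rfl, rfl⟩ := hkey hsa ha hsb hb
  refine Or.inr ⟨hsa, hsb, ⟨{x | K.Reachable a x}, .refl _, ?_, fun x y hxy hx hy => ?_⟩, c, hsc,
    fun h => hcu (h ▸ .refl _), fun h => hcv (h ▸ .refl _)⟩
  · rintro y (rfl | rfl)
    · exact hnr
    · exact hsr a hus
  · rcases hA hxy hx hy with rfl | ⟨rfl, rfl⟩
    · exact ⟨(hkey hxy.symm hx hsb hb).1, by simp⟩
    · exact ⟨rfl, by simp⟩

theorem bridge_or_triangle [Finite V] (hG : G.Connected) (hc : ∀ v, ClawFreeAt G v)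
    (hmin : IsMinimallyTough G (1 / 2)) {u v : V} (huv : G.Adj u v) :
    (∃ A, LeavesOnly G A u {v}) ∨
      ∃ s, G.Adj s u ∧ G.Adj s v ∧ (∃ A, LeavesOnly G A u {v, s}) ∧
        ∃ c, G.Adj s c ∧ c ≠ u ∧ c ≠ v := by
  rcases exists_small_cutset_of_toughness_lt hG hc (hmin.2.2 s(u, v) huv) with h | ⟨s, h⟩
  · refine Or.inl ⟨_, leavesOnly_of_not_reachable fun hr => ?_⟩
    have := numComponents_eq_one
      (hG.connected_delete_edge_of_not_isBridge (x := u) (y := v) fun hb => hb hr)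
    omega
  · have hL := numComponents_isolate_le hc {s}
    rw [numComponents_eq_one hG, Set.ncard_singleton] at hL
    exact (bridge_or_triangle_of_four_le hG (hc s) huv hL h).imp_right fun h => ⟨s, h⟩

/-- In a minimally `1/2`-tough claw-free graph the two edges of a triangle at one of its vertices
form an edge cut, and every vertex of the triangle has a further neighbour. -/
theorem triangle_cut [Finite V] (hG : G.Connected) (hc : ∀ v, ClawFreeAt G v)
    (hmin : IsMinimallyTough G (1 / 2)) {x y z : V} (hxy : G.Adj x y) (hxz : G.Adj x z)
    (hyz : G.Adj y z) :
    (∃ A, LeavesOnly G A x {y, z}) ∧ ∃ c, G.Adj z c ∧ c ≠ x ∧ c ≠ y := by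
  rcases bridge_or_triangle hG hc hmin hxy with ⟨A, hA⟩ | ⟨s, hsx, hsy, ⟨A, hA⟩, hs⟩
  · by_cases hz : z ∈ A
    · exact absurd (hA.cross hyz.symm hz (hA.notMem y rfl)).1 hxz.ne'
    · exact absurd (hA.cross hxz hA.mem hz).2 hyz.ne'
  · obtain rfl : z = s := by
      by_cases hz : z ∈ A
      · exact absurd (hA.cross hyz.symm hz (hA.notMem y (by simp))).1 hxz.ne'
      · exact (hA.cross hxz hA.mem hz).2.resolve_left hyz.ne'
    exact ⟨⟨A, hA⟩, hs⟩

end Edges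

/-! ### Replacing the triangles by stars -/

section Stars

variable {V : Type u} {G : SimpleGraph V}

/-- The triangles of `G`, as sets of three pairwise adjacent vertices. -/
abbrev Triangle (G : SimpleGraph V) : Type u := {t : Finset V // G.IsNClique 3 t}

/-- `G` is connected and claw-free, and its blocks are bridges and triangles: every edge is a bridge
or lies in a triangle, the two edges of a triangle at any of its vertices form an edge cut, and every
vertex of a triangle has a neighbour outside it. -/
structure IsTriangleCactus (G : SimpleGraph V) : Prop where
  connected : G.Connected
  clawFree : ∀ v, ClawFreeAt G v
  bridge_or : ∀ ⦃u v⦄, G.Adj u v → (∃ A, LeavesOnly G A u {v}) ∨ ∃ s, G.Adj s u ∧ G.Adj s v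
  cut : ∀ ⦃x y z⦄, G.Adj x y → G.Adj x z → G.Adj y z → ∃ A, LeavesOnly G A x {y, z}
  exists_adj : ∀ ⦃x y z⦄, G.Adj x y → G.Adj x z → G.Adj y z → ∃ c, G.Adj z c ∧ c ≠ x ∧ c ≠ y

/-- The graph obtained from `G` by replacing every triangle by a star: the edges in triangles are
removed, and each triangle becomes a new vertex joined to its three vertices. -/
def starGraphOfTriangles (G : SimpleGraph V) : SimpleGraph (V ⊕ Triangle G) where
  Adj
    | .inl x, .inl y => G.Adj x y ∧ ∀ t : Triangle G, x ∈ t.1 → y ∉ t.1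
    | .inl x, .inr t => x ∈ t.1
    | .inr t, .inl x => x ∈ t.1
    | .inr _, .inr _ => False
  symm := ⟨by
    rintro (x | t) (y | t') h
    · exact ⟨h.1.symm, fun t hy hx => h.2 t hx hy⟩
    · exact h
    · exact h
    · exact h⟩
  loopless := ⟨by
    rintro (x | t) h
    · exact h.1.ne rfl
    · exact h⟩

theorem Triangle.adj (t : Triangle G) {x y : V} (hx : x ∈ t.1) (hy : y ∈ t.1) (h : x ≠ y) :
    G.Adj x y := t.2.isClique hx hy h

theorem exists_triangle {x y z : V} (hxy : G.Adj x y) (hxz : G.Adj x z) (hyz : G.Adj y z) :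
    ∃ t : Triangle G, x ∈ t.1 ∧ y ∈ t.1 ∧ z ∈ t.1 := by
  classical
  exact ⟨⟨{x, y, z}, SimpleGraph.is3Clique_triple_iff.2 ⟨hxy, hxz, hyz⟩⟩, by simp⟩

theorem Triangle.exists_eq (t : Triangle G) {x : V} (hx : x ∈ t.1) :
    ∃ y z, G.Adj x y ∧ G.Adj x z ∧ G.Adj y z ∧ ∀ w, w ∈ t.1 ↔ w = x ∨ w = y ∨ w = z := by
  classical
  obtain ⟨a, b, c, hab, hac, hbc, ht⟩ := SimpleGraph.is3Clique_iff.1 t.2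
  rw [ht] at hx ⊢
  simp only [Finset.mem_insert, Finset.mem_singleton] at hx ⊢
  rcases hx with rfl | rfl | rfl
  · exact ⟨b, c, hab, hac, hbc, fun w => Iff.rfl⟩
  · exact ⟨a, c, hab.symm, hbc, hac, fun w => by tauto⟩
  · exact ⟨a, b, hac.symm, hbc.symm, hab, fun w => by tauto⟩

namespace IsTriangleCactus

/-- Two triangles with a common edge coincide. -/
theorem triangle_eq (hG : IsTriangleCactus G) {t t' : Triangle G} {x y : V} (hxy : x ≠ y)
    (hx : x ∈ t.1) (hy : y ∈ t.1) (hx' : x ∈ t'.1) (hy' : y ∈ t'.1) : t = t' := by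
  have key : ∀ {t t' : Triangle G}, x ∈ t.1 → y ∈ t.1 → x ∈ t'.1 → y ∈ t'.1 →
      ∀ w ∈ t'.1, w ∈ t.1 := by
    intro t t' hx hy hx' hy' w hw
    obtain ⟨b, c, hxb, hxc, hbc, ht⟩ := t.exists_eq hx
    obtain ⟨A, hA⟩ := hG.cut hxb hxc hbc
    by_contra hwt
    have hwx : w ≠ x := fun h => hwt (h ▸ hx)
    have hwy : w ≠ y := fun h => hwt (h ▸ hy)
    have hyb : y ∈ ({b, c} : Set V) := by
      rcases (ht y).1 hy with h | h | h
      · exact absurd h.symm hxy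
      · exact Or.inl h
      · exact Or.inr h
    by_cases hwA : w ∈ A
    · exact hwx (hA.cross (t'.adj hw hy' hwy) hwA (hA.notMem y hyb)).1
    · exact hwt ((ht w).2 (Or.inr (hA.cross (t'.adj hx' hw hwx.symm) hA.mem hwA).2))
  exact Subtype.ext (Finset.ext fun w => ⟨key hx' hy' hx hy w, key hx hy hx' hy' w⟩)

/-- The side `A` of a cut of `G`, together with the triangles inside `A`. -/
theorem starGraph_leavesOnly {A B : Set V} {u : V} (hA : LeavesOnly G A u B)
    {q : V ⊕ Triangle G} (hq : (∃ v ∈ B, q = .inl v) ∨ ∃ t : Triangle G, q = .inr t ∧ ∃ v ∈ B, v ∈ t.1)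
    (h₁ : ∀ v ∈ B, (starGraphOfTriangles G).Adj (.inl u) (.inl v) → q = .inl v)
    (h₂ : ∀ v ∈ B, ∀ t : Triangle G, u ∈ t.1 → v ∈ t.1 → q = .inr t) :
    LeavesOnly (starGraphOfTriangles G) {p | (∃ x ∈ A, p = .inl x) ∨
      ∃ t : Triangle G, p = .inr t ∧ ∀ x ∈ t.1, x ∈ A} (.inl u) {q} where
  mem := Or.inl ⟨u, hA.mem, rfl⟩
  notMem := by
    rintro _ rfl
    rcases hq with ⟨v, hv, rfl⟩ | ⟨t, rfl, v, hv, hvt⟩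
    · simpa using hA.notMem v hv
    · simpa using ⟨v, hvt, hA.notMem v hv⟩
  cross := by
    rintro (a | t) (b | t') hab ha hb
    · have ha : a ∈ A := by simpa using ha
      have hb : b ∉ A := by simpa using hb
      obtain ⟨rfl, hbB⟩ := hA.cross hab.1 ha hb
      exact ⟨rfl, (h₁ b hbB hab).symm⟩
    · have ha : a ∈ A := by simpa using ha
      have hb : ∃ b ∈ t'.1, b ∉ A := by simpa using hb
      obtain ⟨b, hbt, hb⟩ := hb
      have hat : a ∈ t'.1 := hab
      obtain ⟨rfl, hbB⟩ := hA.cross (t'.adj hat hbt fun h => hb (h ▸ ha)) ha hb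
      exact ⟨rfl, (h₂ b hbB t' hat hbt).symm⟩
    · have ha : ∀ x ∈ t.1, x ∈ A := by simpa using ha
      have hb : b ∉ A := by simpa using hb
      exact absurd (ha b hab) hb
    · exact hab.elim

theorem starGraph_isAcyclic (hG : IsTriangleCactus G) : (starGraphOfTriangles G).IsAcyclic := by
  rw [SimpleGraph.isAcyclic_iff_forall_adj_isBridge]
  have key : ∀ (x : V) (t : Triangle G), x ∈ t.1 →
      (starGraphOfTriangles G).IsBridge s(.inl x, .inr t) := by
    intro x t hx
    obtain ⟨y, z, hxy, hxz, hyz, ht⟩ := t.exists_eq hx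
    obtain ⟨A, hA⟩ := hG.cut hxy hxz hyz
    have hBt : ∀ v ∈ ({y, z} : Set V), v ∈ t.1 ∧ x ≠ v := by
      rintro v (rfl | rfl)
      · exact ⟨(ht v).2 (by simp), hxy.ne⟩
      · exact ⟨(ht v).2 (by simp), hxz.ne⟩
    refine isBridge_of_leavesOnly (starGraph_leavesOnly hA
      (Or.inr ⟨t, rfl, y, by simp, (ht y).2 (by simp)⟩) (fun v hv hxv => ?_)
      (fun v hv t' hxt' hvt' => ?_))
    · exact absurd (hBt v hv).1 (hxv.2 t hx)
    · rw [hG.triangle_eq (hBt v hv).2 hx (hBt v hv).1 hxt' hvt']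
  rintro (x | t) (y | t') hxy
  · rcases hG.bridge_or hxy.1 with ⟨A, hA⟩ | ⟨s, hsx, hsy⟩
    · refine isBridge_of_leavesOnly (starGraph_leavesOnly hA (Or.inl ⟨y, rfl, rfl⟩)
        (fun v hv _ => by rw [Set.mem_singleton_iff.1 hv]) (fun v hv t hxt hvt => ?_))
      rw [Set.mem_singleton_iff.1 hv] at hvt
      exact absurd hvt (hxy.2 t hxt)
    · obtain ⟨t, -, hx, hy⟩ := exists_triangle hsx hsy hxy.1
      exact absurd hy (hxy.2 t hx)
  · exact key x t' hxy
  · rw [Sym2.eq_swap]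
    exact key y t hxy
  · exact hxy.elim

theorem starGraph_isTree (hG : IsTriangleCactus G) : (starGraphOfTriangles G).IsTree := by
  have hadj : ∀ {x y}, G.Adj x y → (starGraphOfTriangles G).Reachable (.inl x) (.inl y) := by
    intro x y hxy
    by_cases ht : ∃ t : Triangle G, x ∈ t.1 ∧ y ∈ t.1
    · obtain ⟨t, hx, hy⟩ := ht
      have h1 : (starGraphOfTriangles G).Adj (.inl x) (.inr t) := hx
      have h2 : (starGraphOfTriangles G).Adj (.inr t) (.inl y) := hy
      exact h1.reachable.trans h2.reachable
    · have h1 : (starGraphOfTriangles G).Adj (.inl x) (.inl y) :=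
        ⟨hxy, fun t hx hy => ht ⟨t, hx, hy⟩⟩
      exact h1.reachable
  obtain ⟨x₀⟩ := hG.connected.nonempty
  have hV : ∀ y, (starGraphOfTriangles G).Reachable (.inl x₀) (.inl y) := fun y =>
    mem_of_reachable (A := {z | (starGraphOfTriangles G).Reachable (.inl x₀) (.inl z)})
      (fun a b hab ha => SimpleGraph.Reachable.trans ha (hadj hab))
      (hG.connected.preconnected x₀ y) (SimpleGraph.Reachable.refl _)
  have hall : ∀ p, (starGraphOfTriangles G).Reachable (.inl x₀) p := by
    rintro (y | t)
    · exact hV y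
    · obtain ⟨y, hy⟩ : t.1.Nonempty := Finset.card_pos.1 (by rw [t.2.card_eq]; norm_num)
      have h1 : (starGraphOfTriangles G).Adj (.inl y) (.inr t) := hy
      exact (hV y).trans h1.reachable
  have : Nonempty (V ⊕ Triangle G) := ⟨.inl x₀⟩
  exact ⟨⟨fun p q => (hall p).symm.trans (hall q)⟩, hG.starGraph_isAcyclic⟩

/-- Every edge at `x` lies in the block given by some neighbour of `x` in the star graph. -/
theorem exists_block {x a : V} (h : G.Adj x a) : ∃ p, (starGraphOfTriangles G).Adj (.inl x) p ∧
    (p = .inl a ∨ ∃ t : Triangle G, p = .inr t ∧ a ∈ t.1) := by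
  by_cases ht : ∃ t : Triangle G, x ∈ t.1 ∧ a ∈ t.1
  · obtain ⟨t, hx, ha⟩ := ht
    exact ⟨.inr t, hx, Or.inr ⟨t, rfl, ha⟩⟩
  · exact ⟨.inl a, ⟨h, fun t hx ha => ht ⟨t, hx, ha⟩⟩, Or.inl rfl⟩

theorem exists_adj_of_block {x : V} {p : V ⊕ Triangle G}
    (h : (starGraphOfTriangles G).Adj (.inl x) p) :
    ∃ a, G.Adj x a ∧ (p = .inl a ∨ ∃ t : Triangle G, p = .inr t ∧ a ∈ t.1) := by
  rcases p with a | t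
  · exact ⟨a, h.1, Or.inl rfl⟩
  · obtain ⟨y, z, hxy, -, -, ht⟩ := t.exists_eq h
    exact ⟨y, hxy, Or.inr ⟨t, rfl, (ht y).2 (by simp)⟩⟩

/-- Neighbours of `x` in different blocks are distinct and not adjacent. -/
theorem block_ne (hG : IsTriangleCactus G) {x a b : V} {p q : V ⊕ Triangle G}
    (hp : (starGraphOfTriangles G).Adj (.inl x) p) (hq : (starGraphOfTriangles G).Adj (.inl x) q)
    (hpq : p ≠ q) (ha : G.Adj x a) (hb : G.Adj x b)
    (hpa : p = .inl a ∨ ∃ t : Triangle G, p = .inr t ∧ a ∈ t.1)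
    (hqb : q = .inl b ∨ ∃ t : Triangle G, q = .inr t ∧ b ∈ t.1) : a ≠ b ∧ ¬ G.Adj a b := by
  constructor
  · rintro rfl
    rcases hpa with rfl | ⟨t, rfl, hat⟩ <;> rcases hqb with rfl | ⟨t', rfl, hbt⟩
    · exact hpq rfl
    · exact hp.2 t' hq hbt
    · exact hq.2 t hp hat
    · exact hpq (by rw [hG.triangle_eq ha.ne hp hat hq hbt])
  · intro hab
    obtain ⟨t₀, hx, ha₀, hb₀⟩ := exists_triangle ha hb hab
    rcases hpa with rfl | ⟨t, rfl, hat⟩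
    · exact hp.2 t₀ hx ha₀
    rcases hqb with rfl | ⟨t', rfl, hbt⟩
    · exact hq.2 t₀ hx hb₀
    exact hpq (by rw [hG.triangle_eq ha.ne hp hat hx ha₀, hG.triangle_eq hb.ne hx hb₀ hq hbt])

section Degrees

variable [Fintype (V ⊕ Triangle G)] [DecidableRel (starGraphOfTriangles G).Adj]

theorem degree_inr (t : Triangle G) : (starGraphOfTriangles G).degree (.inr t) = 3 := by
  have : (starGraphOfTriangles G).neighborFinset (.inr t) = t.1.map ⟨Sum.inl, Sum.inl_injective⟩ := by
    ext p
    rw [SimpleGraph.mem_neighborFinset]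
    rcases p with x | t'
    · simp [starGraphOfTriangles]
    · simp [starGraphOfTriangles]
  rw [← SimpleGraph.card_neighborFinset_eq_degree, this, Finset.card_map, t.2.card_eq]

theorem degree_inl_le (hG : IsTriangleCactus G) (x : V) :
    (starGraphOfTriangles G).degree (.inl x) ≤ 2 := by
  by_contra! h
  rw [← SimpleGraph.card_neighborFinset_eq_degree, Finset.two_lt_card_iff] at h
  obtain ⟨p, q, r, hp, hq, hr, hpq, hpr, hqr⟩ := h
  rw [SimpleGraph.mem_neighborFinset] at hp hq hr
  obtain ⟨a, ha, hpa⟩ := exists_adj_of_block hp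
  obtain ⟨b, hb, hqb⟩ := exists_adj_of_block hq
  obtain ⟨c, hc, hrc⟩ := exists_adj_of_block hr
  have hab := hG.block_ne hp hq hpq ha hb hpa hqb
  have hac := hG.block_ne hp hr hpr ha hc hpa hrc
  have hbc := hG.block_ne hq hr hqr hb hc hqb hrc
  rcases hG.clawFree x ha hb hc hab.1 hac.1 hbc.1 with h | h | h
  · exact hab.2 h
  · exact hac.2 h
  · exact hbc.2 h

theorem degree_inl_ne_one (hG : IsTriangleCactus G) {x : V} {t : Triangle G} (hx : x ∈ t.1) :
    (starGraphOfTriangles G).degree (.inl x) ≠ 1 := by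
  intro h
  rw [SimpleGraph.degree_eq_one_iff_existsUnique_adj] at h
  obtain ⟨y, z, hxy, hxz, hyz, ht⟩ := t.exists_eq hx
  obtain ⟨c, hxc, hcy, hcz⟩ := hG.exists_adj hyz hxy.symm hxz.symm
  obtain ⟨p, hp, hpc⟩ := exists_block hxc
  have hpt : p = .inr t := h.unique hp hx
  rcases hpc with rfl | ⟨t', rfl, hct⟩
  · simp at hpt
  · obtain rfl : t' = t := by simpa using hpt
    rcases (ht c).1 hct with h | h | h
    · exact hxc.ne' h
    · exact hcy h
    · exact hcz h

theorem starGraph_isIndepSet (hG : IsTriangleCactus G) (hne : ∃ x y, x ≠ y ∧ ¬ G.Adj x y) :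
    (starGraphOfTriangles G).IsIndepSet {p | (starGraphOfTriangles G).degree p = 1 ∨
      (starGraphOfTriangles G).degree p = 3} := by
  have key : ∀ (x : V) (t : Triangle G), x ∈ t.1 → ¬ ((starGraphOfTriangles G).degree (.inl x) = 1 ∨
      (starGraphOfTriangles G).degree (.inl x) = 3) := fun x t hx h => by
    have := hG.degree_inl_le x
    have := hG.degree_inl_ne_one hx
    omega
  rintro (x | t) hp (y | t') hq - hpq
  · have hx1 : (starGraphOfTriangles G).degree (.inl x) = 1 := by
      have := hG.degree_inl_le x
      rcases hp with h | h
      · exact h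
      · omega
    have hy1 : (starGraphOfTriangles G).degree (.inl y) = 1 := by
      have := hG.degree_inl_le y
      rcases hq with h | h
      · exact h
      · omega
    rw [SimpleGraph.degree_eq_one_iff_existsUnique_adj] at hx1 hy1
    -- Two adjacent leaves form a whole component, so `G` would be complete.
    have hall : ∀ z : V, z = x ∨ z = y := fun z => by
      have := mem_of_reachable (A := {Sum.inl x, Sum.inl y})
        (fun a b hab ha => by
          rcases ha with rfl | rfl
          · exact Or.inr (hx1.unique hab hpq)
          · exact Or.inl (hy1.unique hab hpq.symm))
        (hG.starGraph_isTree.connected.preconnected (.inl x) (.inl z)) (Or.inl rfl)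
      simpa using this
    obtain ⟨a, b, hab, hnab⟩ := hne
    rcases hall a with rfl | rfl <;> rcases hall b with rfl | rfl
    · exact hab rfl
    · exact hnab hpq.1
    · exact hnab hpq.1.symm
    · exact hab rfl
  · exact key x t' hpq hp
  · exact key y t hpq hq
  · exact hpq

/-- Replacing the degree-`3` vertices of the star graph by triangles restores `G`. -/
theorem nonempty_iso_replaceDegreeThree (hG : IsTriangleCactus G) :
    Nonempty (G ≃g replaceDegreeThree (starGraphOfTriangles G)) := by
  have hdeg : ∀ x : V, (starGraphOfTriangles G).degree (.inl x) ≠ 3 := fun x => by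
    have := hG.degree_inl_le x
    omega
  have hbij : Function.Bijective (fun x : V =>
      (⟨.inl x, hdeg x⟩ : {p // (starGraphOfTriangles G).degree p ≠ 3})) := by
    refine ⟨fun x y h => by simpa using h, ?_⟩
    rintro ⟨x | t, hp⟩
    · exact ⟨x, rfl⟩
    · exact absurd (degree_inr t) hp
  refine ⟨⟨Equiv.ofBijective _ hbij, fun {x y} => ?_⟩⟩
  constructor
  · rintro ⟨hne, h | ⟨w, hw, hx, hy⟩⟩
    · exact h.1
    · rcases w with w | t
      · exact absurd hw (hdeg w)
      · exact t.adj hx hy fun h => hne (by rw [h])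
  · intro hxy
    refine ⟨fun h => hxy.ne (hbij.1 h), ?_⟩
    by_cases ht : ∃ t : Triangle G, x ∈ t.1 ∧ y ∈ t.1
    · obtain ⟨t, hx, hy⟩ := ht
      exact Or.inr ⟨.inr t, degree_inr t, hx, hy⟩
    · exact Or.inl ⟨hxy, fun t hx hy => ht ⟨t, hx, hy⟩⟩

end Degrees

theorem isBuiltFromTree [Finite V] (hG : IsTriangleCactus G) (hne : ∃ x y, x ≠ y ∧ ¬ G.Adj x y) :
    IsBuiltFromTree G := by
  classical
  let : Fintype (V ⊕ Triangle G) := Fintype.ofFinite _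
  refine ⟨V ⊕ Triangle G, inferInstance, starGraphOfTriangles G, Classical.decRel _, ?_,
    hG.starGraph_isTree, SimpleGraph.maxDegree_le_of_forall_degree_le _ 3 ?_,
    hG.starGraph_isIndepSet hne, hG.nonempty_iso_replaceDegreeThree⟩
  · obtain ⟨x, y, hxy, -⟩ := hne
    exact ⟨.inl x, .inl y, fun h => hxy (Sum.inl_injective h)⟩
  · rintro (x | t)
    · exact (hG.degree_inl_le x).trans (by norm_num)
    · exact (degree_inr t).le

end IsTriangleCactus

theorem IsMinimallyTough.isBuiltFromTree [Finite V] (h : IsMinimallyTough G (1 / 2))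
    (hc : IsClawFree G) : IsBuiltFromTree G := by
  have hne := exists_not_adj_of_toughness_ne_top (G := G) (by rw [h.2.1]; exact ENNReal.ofReal_ne_top)
  obtain ⟨x, -⟩ := id hne
  have : Nonempty V := ⟨x⟩
  have hG := h.connected
  have hcl := fun v => hc.clawFreeAt v
  refine IsTriangleCactus.isBuiltFromTree ⟨hG, hcl, fun u v huv => ?_, fun x y z hxy hxz hyz =>
    (triangle_cut hG hcl h hxy hxz hyz).1, fun x y z hxy hxz hyz =>
    (triangle_cut hG hcl h hxy hxz hyz).2⟩ hne
  exact (bridge_or_triangle hG hcl h huv).imp_right fun ⟨s, hu, hv, _⟩ => ⟨s, hu, hv⟩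

end Stars

/-! ### Graphs built from trees -/

section Build

variable {V W : Type*} {G : SimpleGraph V} {T : SimpleGraph W} [Fintype W] [DecidableRel T.Adj]
  {ι : V → W}

/-- `G` arises from the tree `T` by replacing the vertices of degree `3` by triangles, where `ι`
identifies the vertices of `G` with the vertices of `T` of degree other than `3`. -/
structure IsExpansion (G : SimpleGraph V) (T : SimpleGraph W) [Fintype W] [DecidableRel T.Adj]
    (ι : V → W) : Prop where
  isTree : T.IsTree
  degree_le : ∀ w, T.degree w ≤ 3
  indep : ∀ ⦃p q⦄, T.Adj p q → (T.degree p = 1 ∨ T.degree p = 3) →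
    ¬ (T.degree q = 1 ∨ T.degree q = 3)
  inj : Function.Injective ι
  degree_ne : ∀ x, T.degree (ι x) ≠ 3
  exists_eq : ∀ ⦃w⦄, T.degree w ≠ 3 → ∃ x, ι x = w
  adj_iff : ∀ ⦃x y⦄, G.Adj x y ↔ x ≠ y ∧
    (T.Adj (ι x) (ι y) ∨ ∃ w, T.degree w = 3 ∧ T.Adj w (ι x) ∧ T.Adj w (ι y))

theorem isExpansion_of_iso (h₁ : T.IsTree) (h₂ : T.maxDegree ≤ 3)
    (h₃ : T.IsIndepSet {v | T.degree v = 1 ∨ T.degree v = 3}) (φ : G ≃g replaceDegreeThree T) :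
    IsExpansion G T (fun x => (φ x).1) where
  isTree := h₁
  degree_le w := (T.degree_le_maxDegree w).trans h₂
  indep p q hpq hp hq := h₃ hp hq hpq.ne hpq
  inj := Subtype.val_injective.comp φ.injective
  degree_ne x := (φ x).2
  exists_eq w hw := ⟨φ.symm ⟨w, hw⟩, by simp⟩
  adj_iff x y := by
    rw [← φ.map_adj_iff]
    exact and_congr_left' (not_congr φ.injective.eq_iff)

theorem exists_adj_ne_of_one_lt_degree {p q : W} (h : 1 < T.degree p) :
    ∃ r, T.Adj p r ∧ r ≠ q := by
  rw [← SimpleGraph.card_neighborFinset_eq_degree] at h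
  obtain ⟨r, hr, hrq⟩ := Finset.exists_mem_ne h q
  exact ⟨r, (T.mem_neighborFinset p r).1 hr, hrq⟩

theorem exists_third_of_degree_eq_three {w p q : W} (h : T.degree w = 3) (hp : T.Adj w p)
    (hq : T.Adj w q) (hpq : p ≠ q) :
    ∃ r, T.Adj w r ∧ r ≠ p ∧ r ≠ q ∧ ∀ s, T.Adj w s → s = p ∨ s = q ∨ s = r := by
  classical
  have hc : ((T.neighborFinset w).erase p |>.erase q).card = 1 := by
    rw [Finset.card_erase_of_mem (by simp [hq, hpq.symm]), Finset.card_erase_of_mem (by simp [hp]),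
      SimpleGraph.card_neighborFinset_eq_degree, h]
  obtain ⟨r, hr⟩ := Finset.card_eq_one.1 hc
  have hmem : ∀ s, (s ≠ q ∧ s ≠ p ∧ T.Adj w s) ↔ s = r := fun s => by
    rw [← Finset.mem_singleton, ← hr]
    simp
  have hr' := (hmem r).2 rfl
  refine ⟨r, hr'.2.2, hr'.2.1, hr'.1, fun s hs => ?_⟩
  have := hmem s
  tauto

namespace IsExpansion

theorem degree_eq_two (h : IsExpansion G T ι) {p q : W} (hpq : T.Adj p q)
    (hp : T.degree p = 1 ∨ T.degree p = 3) : T.degree q = 2 := by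
  have h1 := h.indep hpq hp
  have h2 := h.degree_le q
  have h3 : 0 < T.degree q := (T.degree_pos_iff_exists_adj q).2 ⟨p, hpq.symm⟩
  omega

/-- Following an edge of `T` from a vertex of `G`, if need be across a vertex of degree `3`, leads
to a neighbour in `G`. -/
theorem exists_adj_beyond (h : IsExpansion G T ι) {z : V} {w : W} (hzw : T.Adj (ι z) w) :
    ∃ r, G.Adj z r ∧ (ι r = w ∨ T.Adj w (ι r)) := by
  by_cases hw : T.degree w = 3
  · obtain ⟨p, hp, hpz⟩ := exists_adj_ne_of_one_lt_degree (T := T) (p := w) (q := ι z) (by omega)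
    obtain ⟨r, rfl⟩ := h.exists_eq (w := p) (by rw [h.degree_eq_two hp (Or.inr hw)]; norm_num)
    exact ⟨r, h.adj_iff.2 ⟨fun hzr => hpz (by rw [hzr]), Or.inr ⟨w, hw, hzw.symm, hp⟩⟩, Or.inr hp⟩
  · obtain ⟨r, rfl⟩ := h.exists_eq hw
    exact ⟨r, h.adj_iff.2 ⟨fun hzr => hzw.ne (by rw [hzr]), Or.inl hzw⟩, Or.inl rfl⟩

theorem connected (h : IsExpansion G T ι) [Nontrivial W] : G.Connected := by
  obtain ⟨v, hv⟩ := h.isTree.exists_vert_degree_one_of_nontrivial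
  obtain ⟨x₀, -⟩ := h.exists_eq (w := v) (by omega)
  have : Nonempty V := ⟨x₀⟩
  refine ⟨fun x y => ?_⟩
  let A : Set W := {w | (∃ y, ι y = w ∧ G.Reachable x y) ∨
    (T.degree w = 3 ∧ ∃ y, T.Adj w (ι y) ∧ G.Reachable x y)}
  have hA : ι y ∈ A := by
    refine mem_of_reachable (fun a b hab ha => ?_) (h.isTree.connected.preconnected (ι x) (ι y))
      (Or.inl ⟨x, rfl, .refl x⟩)
    rcases ha with ⟨z, rfl, hz⟩ | ⟨ha3, z, haz, hz⟩
    · by_cases hb : T.degree b = 3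
      · exact Or.inr ⟨hb, z, hab.symm, hz⟩
      · obtain ⟨b, rfl⟩ := h.exists_eq hb
        exact Or.inl ⟨b, rfl, hz.trans (SimpleGraph.Adj.reachable
          (h.adj_iff.2 ⟨fun hzb => hab.ne (by rw [hzb]), Or.inl hab⟩))⟩
    · obtain ⟨b, rfl⟩ := h.exists_eq (w := b)
        (by rw [h.degree_eq_two hab (Or.inr ha3)]; norm_num)
      refine Or.inl ⟨b, rfl, ?_⟩
      by_cases hzb : z = b
      · exact hzb ▸ hz
      · exact hz.trans (SimpleGraph.Adj.reachable (h.adj_iff.2 ⟨hzb, Or.inr ⟨a, ha3, haz, hab⟩⟩))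
  rcases hA with ⟨z, hz, hr⟩ | ⟨h3, -⟩
  · exact h.inj hz ▸ hr
  · exact absurd h3 (h.degree_ne y)

theorem clawFreeAt (h : IsExpansion G T ι) (v : V) : ClawFreeAt G v := by
  have via : ∀ {a}, G.Adj v a → ∃ p, T.Adj (ι v) p ∧
      (p = ι a ∨ (T.degree p = 3 ∧ T.Adj p (ι a))) := fun {a} ha => by
    rcases (h.adj_iff.1 ha).2 with hva | ⟨w, hw, hv, ha⟩
    · exact ⟨_, hva, Or.inl rfl⟩
    · exact ⟨w, hv.symm, Or.inr ⟨hw, ha⟩⟩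
  have key : ∀ {a b p}, a ≠ b → (p = ι a ∨ (T.degree p = 3 ∧ T.Adj p (ι a))) →
      (p = ι b ∨ (T.degree p = 3 ∧ T.Adj p (ι b))) → G.Adj a b := fun {a b p} hab ha hb => by
    rcases ha with rfl | ⟨hp, ha⟩ <;> rcases hb with hb | ⟨hp', hb⟩
    · exact absurd (h.inj hb) hab
    · exact absurd hp' (h.degree_ne a)
    · exact absurd (hb ▸ hp) (h.degree_ne b)
    · exact h.adj_iff.2 ⟨hab, Or.inr ⟨p, hp, ha, hb⟩⟩
  intro a b c ha hb hc hab hac hbc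
  obtain ⟨p, hp, hpa⟩ := via ha
  obtain ⟨q, hq, hqb⟩ := via hb
  obtain ⟨r, hr, hrc⟩ := via hc
  by_cases hpq : p = q
  · exact Or.inl (key hab hpa (hpq ▸ hqb))
  by_cases hpr : p = r
  · exact Or.inr (Or.inl (key hac hpa (hpr ▸ hrc)))
  by_cases hqr : q = r
  · exact Or.inr (Or.inr (key hbc hqb (hqr ▸ hrc)))
  have h3 : 2 < (T.neighborFinset (ι v)).card := Finset.two_lt_card_iff.2
    ⟨p, q, r, by simpa, by simpa, by simpa, hpq, hpr, hqr⟩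
  rw [SimpleGraph.card_neighborFinset_eq_degree] at h3
  have := h.degree_le (ι v)
  have := h.degree_ne v
  omega

/-- An edge of `T` between vertices of `G` is a bridge of `G`. -/
theorem leavesOnly_of_adj (h : IsExpansion G T ι) {x y : V} {A : Set W}
    (hA : LeavesOnly T A (ι x) {ι y}) : LeavesOnly G (ι ⁻¹' A) x {y} where
  mem := hA.mem
  notMem := by
    rintro _ rfl
    exact hA.notMem _ rfl
  cross a b hab ha hb := by
    rcases (h.adj_iff.1 hab).2 with hab | ⟨w, hw, hwa, hwb⟩
    · exact (hA.cross hab ha hb).imp (fun e => h.inj e) fun e => h.inj e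
    · by_cases hwA : w ∈ A
      · exact absurd ((hA.cross hwb hwA hb).1 ▸ hw) (h.degree_ne x)
      · exact absurd ((hA.cross hwa.symm ha hwA).2 ▸ hw) (h.degree_ne y)

/-- An edge of `T` from `ι x` to a vertex `w` of degree `3` corresponds to the edge cut formed by
the two edges at `x` of the triangle replacing `w`. -/
theorem leavesOnly_of_degree_eq_three (h : IsExpansion G T ι) {x : V} {w : W} {A : Set W}
    (hw : T.degree w = 3) (hA : LeavesOnly T A (ι x) {w}) :
    LeavesOnly G (ι ⁻¹' A) x {b | b ≠ x ∧ T.Adj w (ι b)} where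
  mem := hA.mem
  notMem b hb hbA := hb.1 (h.inj (hA.cross hb.2.symm hbA (hA.notMem w rfl)).1)
  cross a b hab ha hb := by
    obtain ⟨hne, hab | ⟨w', hw', hwa, hwb⟩⟩ := h.adj_iff.1 hab
    · exact absurd ((hA.cross hab ha hb).2 ▸ hw) (h.degree_ne b)
    · by_cases hwA : w' ∈ A
      · exact absurd ((hA.cross hwb hwA hb).1 ▸ hw') (h.degree_ne x)
      · obtain ⟨hax, hww⟩ := hA.cross hwa.symm ha hwA
        obtain rfl : a = x := h.inj hax
        obtain rfl : w' = w := hww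
        exact ⟨rfl, hne.symm, hwb⟩

theorem toughness_le_half [Finite V] (h : IsExpansion G T ι) [Nontrivial W] :
    toughness G ≤ ENNReal.ofReal (1 / 2) := by
  obtain ⟨v, hv⟩ := h.isTree.exists_vert_degree_one_of_nontrivial
  obtain ⟨u, hvu, huniq⟩ := SimpleGraph.degree_eq_one_iff_existsUnique_adj.1 hv
  have hu := h.degree_eq_two hvu (Or.inl hv)
  obtain ⟨x, rfl⟩ := h.exists_eq (w := v) (by omega)
  obtain ⟨y, rfl⟩ := h.exists_eq (w := u) (by omega)
  obtain ⟨q, hq, hqx⟩ := exists_adj_ne_of_one_lt_degree (T := T) (p := ι y) (q := ι x) (by omega)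
  obtain ⟨r, hyr, hr⟩ := h.exists_adj_beyond hq
  have hrx : r ≠ x := by
    rintro rfl
    rcases hr with rfl | hr
    · exact hqx rfl
    · exact hq.ne (huniq q hr.symm).symm
  -- The neighbour `y` of a leaf `x` of the tree is a cut vertex.
  have h2 : 2 ≤ numComponents (deleteVerts G {y}) := by
    refine two_le_numComponents_deleteVerts (A := {x}) (fun a b hab _ hb ha => ?_)
      (x := x) (y := r) ?_ hyr.ne' rfl hrx
    · rw [Set.mem_singleton_iff] at ha
      subst ha
      refine absurd (h.inj ?_) hb
      rcases (h.adj_iff.1 hab).2 with hab | ⟨w, hw, hwa, -⟩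
      · exact huniq _ hab
      · rw [huniq w hwa.symm] at hw
        omega
    · rintro rfl
      exact hvu.ne rfl
  simpa using toughness_le_of_le_numComponents one_lt_two h2

theorem toughness_deleteEdges_lt [Finite V] (h : IsExpansion G T ι) {x y : V} (hxy : G.Adj x y) :
    toughness (G.deleteEdges {s(x, y)}) < ENNReal.ofReal (1 / 2) := by
  rcases (h.adj_iff.1 hxy).2 with hadj | ⟨w, hw, hwx, hwy⟩
  · obtain ⟨A, hA⟩ := exists_leavesOnly_of_isTree h.isTree hadj
    have hA' := h.leavesOnly_of_adj hA
    have h2 : 2 ≤ numComponents (deleteVerts (G.deleteEdges {s(x, y)}) ∅) := by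
      refine two_le_numComponents_deleteVerts (A := ι ⁻¹' A) (fun a b hab _ _ ha => ?_)
        (Set.notMem_empty x) (Set.notMem_empty y) hA'.mem (hA'.notMem y rfl)
      rw [deleteEdges_adj_iff] at hab
      by_contra hb
      exact hab.2 (Or.inl (hA'.cross hab.1 ha hb))
    refine (toughness_le_of_le_numComponents one_lt_two h2).trans_lt ?_
    rw [ENNReal.ofReal_lt_ofReal_iff (by norm_num)]
    norm_num
  · have hιxy : ι x ≠ ι y := fun e => hxy.ne (h.inj e)
    obtain ⟨p, hwp, hpx, hpy, hall⟩ := exists_third_of_degree_eq_three hw hwx hwy hιxy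
    have hp := h.degree_eq_two hwp (Or.inr hw)
    obtain ⟨z, rfl⟩ := h.exists_eq (w := p) (by omega)
    obtain ⟨q, hq, hqw⟩ := exists_adj_ne_of_one_lt_degree (T := T) (p := ι z) (q := w) (by omega)
    obtain ⟨r, hzr, hr⟩ := h.exists_adj_beyond hq
    obtain ⟨A, hA⟩ := exists_leavesOnly_of_isTree h.isTree hwx.symm
    obtain ⟨B, hB⟩ := exists_leavesOnly_of_isTree h.isTree hwy.symm
    have hA' := h.leavesOnly_of_degree_eq_three hw hA
    have hB' := h.leavesOnly_of_degree_eq_three hw hB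
    -- The path from `w` through `z` to `r` avoids the edges from `w` to `x` and `y`.
    have hrC : ∀ {C : Set W} {p}, LeavesOnly T C p {w} → ι z ∉ C → ι r ∉ C :=
      fun {C p} hC hzC => by
        have hqC : q ∉ C := fun hqC =>
          absurd ((hC.cross hq.symm hqC hzC).2 ▸ hw) (h.degree_ne z)
        rcases hr with rfl | hr
        · exact hqC
        · exact fun hrC => hqw (hC.cross hr.symm hrC hqC).2
    have hxz : z ≠ x := fun e => hpx (by rw [e])
    have hyz : z ≠ y := fun e => hpy (by rw [e])
    have hzA : ι z ∉ A := hA'.notMem z ⟨hxz, hwp⟩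
    have hzB : ι z ∉ B := hB'.notMem z ⟨hyz, hwp⟩
    have h3 : 3 ≤ numComponents (deleteVerts (G.deleteEdges {s(x, y)}) {z}) := by
      refine three_le_numComponents_deleteVerts (A := ι ⁻¹' A) (B := ι ⁻¹' B)
        (fun a b hab _ hbz ha => ?_) (fun a b hab _ hbz ha => ?_) hxz.symm hyz.symm hzr.ne' hA'.mem
        (hA'.notMem y ⟨hxy.ne', hwy⟩) hB'.mem (hrC hA hzA) (hrC hB hzB)
      · rw [deleteEdges_adj_iff] at hab
        by_contra hb
        obtain ⟨rfl, hbx, hwb⟩ := hA'.cross hab.1 ha hb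
        rcases hall _ hwb with e | e | e
        · exact hbx (h.inj e)
        · exact hab.2 (Or.inl ⟨rfl, h.inj e⟩)
        · exact hbz (h.inj e)
      · rw [deleteEdges_adj_iff] at hab
        by_contra hb
        obtain ⟨rfl, hby, hwb⟩ := hB'.cross hab.1 ha hb
        rcases hall _ hwb with e | e | e
        · exact hab.2 (Or.inr ⟨rfl, h.inj e⟩)
        · exact hby (h.inj e)
        · exact hbz (h.inj e)
    refine (toughness_le_of_le_numComponents (by norm_num) h3).trans_lt ?_
    rw [ENNReal.ofReal_lt_ofReal_iff (by norm_num), Set.ncard_singleton]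
    norm_num

theorem isMinimallyTough [Finite V] (h : IsExpansion G T ι) [Nontrivial W] :
    IsMinimallyTough G (1 / 2) := by
  refine ⟨by norm_num, h.toughness_le_half.antisymm
    (le_toughness (by norm_num) (isTough_half h.connected h.clawFreeAt)), fun e he => ?_⟩
  induction e with
  | h x y => exact h.toughness_deleteEdges_lt he

end IsExpansion

end Build

end Toughness

theorem mainTheorem7 {V : Type*} [Finite V] (G : SimpleGraph V) :
    ((Toughness.IsMinimallyTough G (1 / 2) ∧ Toughness.IsClawFree G) ↔
      Toughness.IsBuiltFromTree G) ∧
    (Toughness.IsBuiltFromTree G → G.Connected) := by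
  refine ⟨⟨fun h => h.1.isBuiltFromTree h.2, ?_⟩, ?_⟩
  · rintro ⟨W, _, T, _, _, h₁, h₂, h₃, ⟨φ⟩⟩
    have h := Toughness.isExpansion_of_iso h₁ h₂ h₃ φ
    exact ⟨h.isMinimallyTough, Toughness.isClawFree_of_clawFreeAt h.clawFreeAt⟩
  · rintro ⟨W, _, T, _, _, h₁, h₂, h₃, ⟨φ⟩⟩
    exact (Toughness.isExpansion_of_iso h₁ h₂ h₃ φ).connected
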